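/- There is an absolute constant $C>0$ with the following property. Let $n,m\ge 1$ be integers, let $\mu\in\mathbb{R}^n$, and let $\Sigma_1,\Sigma_2$ be symmetric positive definite $n\times n$ matrices. Write $\lambda_1(A)\ge\lambda_2(A)\ge\cdots$ for the ordered eigenvalues of a symmetric matrix $A$, and suppose that $\lambda_1(\Sigma_i)>\lambda_2(\Sigma_i)$ for $i=1,2$ (no condition if $n=1$) and that, for some $\beta>0$, the vector $2\beta\mu$ is a unit-length eigenvector of both $\Sigma_1$ and $\Sigma_2$ for their respective largest eigenvalues. Let $$X=\theta\mu+g^{(\theta)},$$ where $P(\theta=1)=P(\theta=-1)=\tfrac12$, and $g^{(1)}\sim\mathcal N_n(0,\Sigma_1)$ and $g^{(-1)}\sim\mathcal N_n(0,\Sigma_2)$ are independent of $\theta$; put $\Sigma=E[XX^\top]$. Let $K\ge 1$ be any constant such that $$\|\langle X,x\rangle\|_{\psi_2}\le K\,\|\langle X,x\rangle\|_{L^2}\qquad\text{for all }x\in\mathbb{R}^n,$$ where $\|Y\|_{\psi_2}=\inf\{t>0: E\exp(Y^2/t^2)\le 2\}$. Let $X_1,\dots,X_m$ be i.i.d. copies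 of $X$ and $S_m=\frac1m\sum_{i=1}^m X_iX_i^\top$. Then for every $u\ge 0$, $$P\left(\|S_m-\Sigma\|_{\mathrm{op}}\le C K^2\left(\sqrt{\frac{n+u}{m}}+\frac{n+u}{m}\right)\left(\frac{\lambda_1(\Sigma_1)+\lambda_1(\Sigma_2)}{2}+\|\mu\|_2^2\right)\right)\ge 1-2e^{-u},$$ where $\|\cdot\|_{\mathrm{op}}$ is the operator norm with respect to the Euclidean norm. -/

import Mathlib

open MeasureTheory ProbabilityTheory
open scoped ENNReal RealInnerProductSpace

namespace AllometricMixture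

/-- The sub-gaussian (Orlicz `ψ₂`) norm of a real random variable `Y`:
the infimum of all `t > 0` with `E exp (Y² / t²) ≤ 2`, equal to `∞` if there is no such `t`. -/
noncomputable def psi2Norm {Ω : Type*} [MeasurableSpace Ω] (Y : Ω → ℝ) (P : Measure Ω) : ℝ≥0∞ :=
  ⨅ (t : ℝ) (_ : 0 < t ∧ ∫⁻ ω, ENNReal.ofReal (Real.exp (Y ω ^ 2 / t ^ 2)) ∂P ≤ 2),
    ENNReal.ofReal t

/-- The eigenvalues of a symmetric matrix in decreasing order, with multiplicity. The indices
start from `0`, so that the `k`-th largest eigenvalue is `orderedEigenvalue hA (k - 1)`. -/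
noncomputable def orderedEigenvalue {n : ℕ} {A : Matrix (Fin n) (Fin n) ℝ} (hA : A.IsHermitian)
    (k : Fin n) : ℝ :=
  hA.eigenvalues₀ (Fin.cast (Fintype.card_fin n).symm k)

/-- The largest eigenvalue of a symmetric matrix of positive size. -/
noncomputable def lambda1 {n : ℕ} (hn : 0 < n) {A : Matrix (Fin n) (Fin n) ℝ}
    (hA : A.IsHermitian) : ℝ :=
  orderedEigenvalue hA ⟨0, hn⟩

/-- `v` is a unit-length eigenvector for the largest eigenvalue of the symmetric matrix `A`. -/
def IsLeadingEigenvector {n : ℕ} (hn : 0 < n) {A : Matrix (Fin n) (Fin n) ℝ}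
    (hA : A.IsHermitian) (v : EuclideanSpace ℝ (Fin n)) : Prop :=
  ‖v‖ = 1 ∧ Matrix.toEuclideanCLM (n := Fin n) (𝕜 := ℝ) A v = lambda1 hn hA • v

/-- The parameters of the model: `S₁`, `S₂` are positive definite, their largest eigenvalues are
strictly larger than their second largest ones (void in dimension one), and they have the
common unit-length leading eigenvector `2 β μ` for some `β > 0`. -/
structure IsAllometric {n : ℕ} (hn : 0 < n) (μ : EuclideanSpace ℝ (Fin n))
    (S₁ S₂ : Matrix (Fin n) (Fin n) ℝ) : Prop where
  posDef₁ : S₁.PosDef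
  posDef₂ : S₂.PosDef
  gap₁ : ∀ h : 1 < n, orderedEigenvalue posDef₁.isHermitian ⟨1, h⟩ < lambda1 hn posDef₁.isHermitian
  gap₂ : ∀ h : 1 < n, orderedEigenvalue posDef₂.isHermitian ⟨1, h⟩ < lambda1 hn posDef₂.isHermitian
  leading : ∃ β : ℝ, 0 < β ∧ IsLeadingEigenvector hn posDef₁.isHermitian ((2 * β) • μ) ∧
    IsLeadingEigenvector hn posDef₂.isHermitian ((2 * β) • μ)

/-- `X = θ μ + g^(θ)`, where `θ` is a symmetric Bernoulli variable (with values `1` and `-1`),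
and `g^(1) = g₁ ∼ N(0, S₁)` and `g^(-1) = g₂ ∼ N(0, S₂)` are independent of `θ`. -/
structure IsMixture {Ω : Type*} [MeasurableSpace Ω] {n : ℕ} (P : Measure Ω)
    (μ : EuclideanSpace ℝ (Fin n)) (S₁ S₂ : Matrix (Fin n) (Fin n) ℝ)
    (θ : Ω → ℝ) (g₁ g₂ X : Ω → EuclideanSpace ℝ (Fin n)) : Prop where
  aemeasurable_theta : AEMeasurable θ P
  theta_pos : P {ω | θ ω = 1} = 1 / 2
  theta_neg : P {ω | θ ω = -1} = 1 / 2
  law₁ : HasLaw g₁ (multivariateGaussian 0 S₁) P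
  law₂ : HasLaw g₂ (multivariateGaussian 0 S₂) P
  indep₁ : IndepFun θ g₁ P
  indep₂ : IndepFun θ g₂ P
  eq_mixture : ∀ ω, X ω = θ ω • μ + (if θ ω = 1 then g₁ ω else g₂ ω)

/-- The matrix `E[X Xᵀ]`, the covariance matrix of a centered random vector. -/
noncomputable def covMatrix {Ω : Type*} [MeasurableSpace Ω] {n : ℕ} (P : Measure Ω)
    (X : Ω → EuclideanSpace ℝ (Fin n)) : Matrix (Fin n) (Fin n) ℝ :=
  Matrix.of fun i j => ∫ ω, X ω i * X ω j ∂P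

/-- The sample covariance matrix `m⁻¹ ∑ i, x i (x i)ᵀ` of `m` centered data points. -/
noncomputable def sampleCov {m n : ℕ} (x : Fin m → EuclideanSpace ℝ (Fin n)) :
    Matrix (Fin n) (Fin n) ℝ :=
  (1 / (m : ℝ)) • ∑ i, Matrix.vecMulVec (x i).ofLp (x i).ofLp

/-- The operator norm of a square matrix with respect to the Euclidean norm. -/
noncomputable def opNorm {n : ℕ} (A : Matrix (Fin n) (Fin n) ℝ) : ℝ :=
  ‖Matrix.toEuclideanCLM (n := Fin n) (𝕜 := ℝ) A‖

end AllometricMixture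

namespace AllometricMixture

/-! The deviation of the sample covariance from `E[XXᵀ]` is symmetric, so its norm is a supremum of
quadratic forms over the unit sphere, and a `1/2`-net of at most `5 ^ n` points suffices
(`exists_half_net_unit_sphere`, `norm_le_of_forall_mem_half_net`). In a fixed direction `x` the form
is a centered average of i.i.d. squares `⟪X, x⟫ ^ 2`. Divided by `T ^ 2`, with `T` above the
`ψ₂`-norm of the marginal, they have exponential moment at most `2`, so Bernstein's inequality
(`measureReal_abs_average_ge_le`) bounds the deviation by `T ^ 2 * 90 * (√r + r)` outside an event
of probability `2 * exp (-m r)`.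

The choice `r = 3 (n + u) / m` pays for the union bound over the net. The mixture enters only
through `E ⟪X, x⟫ ^ 2 ≤ 4Λ`, where `Λ` is the mean top eigenvalue plus `‖μ‖ ^ 2`
(`IsMixture.eLpNorm_inner_le`). With the sub-gaussian hypothesis this allows `T = 2K√(4Λ)`. -/

/-! ### Nets and operator norms -/

/-- The unit sphere of a `d`-dimensional Euclidean space has a `1/2`-net with at most `5 ^ d`
points. -/
lemma exists_half_net_unit_sphere (E : Type*) [NormedAddCommGroup E] [NormedSpace ℝ E]
    [FiniteDimensional ℝ E] :
    ∃ N : Finset E, N.card ≤ 5 ^ Module.finrank ℝ E ∧ (∀ y ∈ N, ‖y‖ = 1) ∧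
      ∀ x : E, ‖x‖ = 1 → ∃ y ∈ N, ‖x - y‖ < 1 / 2 := by
  classical
  have hcard : ∀ s : Finset E, (∀ y ∈ s, ‖y‖ = 1) →
      (∀ c ∈ s, ∀ d ∈ s, c ≠ d → 1 / 2 ≤ ‖c - d‖) → s.card ≤ 5 ^ Module.finrank ℝ E := by
    intro s h1 h2
    -- Doubling gives a `1`-separated set in the ball of radius `2`, the setting of the Besicovitch
    -- volume bound.
    have hinj : Function.Injective (fun x : E => (2 : ℝ) • x) :=
      smul_right_injective E two_ne_zero
    rw [← Finset.card_image_of_injective s hinj]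
    refine Besicovitch.card_le_of_separated _ ?_ ?_
    · simp only [Finset.mem_image, forall_exists_index, and_imp]
      rintro _ y hy rfl
      simp [norm_smul, h1 y hy]
    · simp only [Finset.mem_image, forall_exists_index, and_imp]
      rintro _ c hc rfl _ d hd rfl hne
      have := h2 c hc d hd (fun h => hne (by rw [h]))
      rw [← smul_sub, norm_smul, Real.norm_ofNat]
      linarith
  by_contra! hcon
  -- If no separated set were a net, each could be enlarged by a point, against the cardinality
  -- bound.
  have hall : ∀ k : ℕ, ∃ s : Finset E, s.card = k ∧ (∀ y ∈ s, ‖y‖ = 1) ∧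
      (∀ c ∈ s, ∀ d ∈ s, c ≠ d → 1 / 2 ≤ ‖c - d‖) := by
    intro k
    induction k with
    | zero => exact ⟨∅, by simp⟩
    | succ k ih =>
      obtain ⟨s, hk, h1, h2⟩ := ih
      obtain ⟨x, hx, hxs⟩ := hcon s (hcard s h1 h2) h1
      have hxn : x ∉ s := fun h => by
        have := hxs x h
        norm_num at this
      refine ⟨insert x s, by rw [Finset.card_insert_of_notMem hxn, hk], ?_, ?_⟩
      · intro y hy
        rcases Finset.mem_insert.1 hy with rfl | hy
        exacts [hx, h1 y hy]
      · intro c hc d hd hne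
        rcases Finset.mem_insert.1 hc with hcx | hcs <;>
          rcases Finset.mem_insert.1 hd with hdx | hds
        · exact absurd (hcx.trans hdx.symm) hne
        · exact hcx ▸ hxs d hds
        · rw [norm_sub_rev]
          exact hdx ▸ hxs c hcs
        · exact h2 c hcs d hds hne
  obtain ⟨s, hk, h1, h2⟩ := hall (5 ^ Module.finrank ℝ E + 1)
  have := hcard s h1 h2
  omega

/-- The quadratic form of a symmetric operator, controlled on a `1/2`-net of the unit sphere,
controls its norm. -/
lemma norm_le_of_forall_mem_half_net {E : Type*} [NormedAddCommGroup E] [InnerProductSpace ℝ E]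
    (T : E →L[ℝ] E) (hT : ∀ x y, ⟪T x, y⟫ = ⟪x, T y⟫) {N : Finset E} (hN : ∀ y ∈ N, ‖y‖ = 1)
    (hnet : ∀ x : E, ‖x‖ = 1 → ∃ y ∈ N, ‖x - y‖ < 1 / 2) {δ : ℝ} (hδ : 0 ≤ δ)
    (h : ∀ y ∈ N, |⟪T y, y⟫| ≤ δ) : ‖T‖ ≤ 32 * δ := by
  have hTn : 0 ≤ ‖T‖ := norm_nonneg T
  have hquad : ∀ x, ‖x‖ = 1 → |⟪T x, x⟫| ≤ δ + 31 / 32 * ‖T‖ := by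
    intro x hx
    obtain ⟨y, hy, hxy⟩ := hnet x hx
    have hy1 := hN y hy
    have e : ⟪T x, x⟫ = ⟪T y, y⟫ + ⟪T (x + y), x - y⟫ := by
      have h1 : ⟪T x, y⟫ = ⟪T y, x⟫ := by rw [hT x y, real_inner_comm]
      simp only [map_add, inner_add_left, inner_sub_right]
      linarith
    have hpar := parallelogram_law_with_norm ℝ x y
    -- With `s = ‖x - y‖ ^ 2 ≤ 1/4` the squared product is `(4 - s) s ≤ 15/16 = 960/1024`, just
    -- below `(31/32) ^ 2`. Absorbing `31/32 * ‖T‖` then gives the factor `32`.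
    have hprod : ‖x + y‖ * ‖x - y‖ ≤ 31 / 32 := by
      have ha : 0 ≤ ‖x + y‖ := norm_nonneg _
      have hb : 0 ≤ ‖x - y‖ := norm_nonneg _
      rw [hx, hy1] at hpar
      have hb2 : ‖x - y‖ ^ 2 ≤ 1 / 4 := by nlinarith
      have : (‖x + y‖ * ‖x - y‖) ^ 2 ≤ (31 / 32) ^ 2 := by
        have : (‖x + y‖ * ‖x - y‖) ^ 2 = (4 - ‖x - y‖ ^ 2) * ‖x - y‖ ^ 2 := by
          rw [mul_pow]; congr 1; linarith
        rw [this]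
        nlinarith
      exact abs_le_of_sq_le_sq' this (by norm_num) |>.2
    have hin : |⟪T (x + y), x - y⟫| ≤ 31 / 32 * ‖T‖ := by
      calc |⟪T (x + y), x - y⟫| ≤ ‖T (x + y)‖ * ‖x - y‖ := abs_real_inner_le_norm _ _
        _ ≤ (‖T‖ * ‖x + y‖) * ‖x - y‖ := by gcongr; exact T.le_opNorm _
        _ = ‖T‖ * (‖x + y‖ * ‖x - y‖) := by ring
        _ ≤ ‖T‖ * (31 / 32) := by gcongr
        _ = _ := by ring
    rw [e]
    exact (abs_add_le _ _).trans (add_le_add (h y hy) hin)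
  have hnorm : ‖T‖ ≤ δ + 31 / 32 * ‖T‖ := by
    have hsym : (T : E →ₗ[ℝ] E).IsSymmetric := fun x y => hT x y
    refine (T.norm_eq_iSup_rayleighQuotient hsym).le.trans (ciSup_le fun x => ?_)
    rcases eq_or_ne x 0 with rfl | hx
    · rw [ContinuousLinearMap.rayleighQuotient, norm_zero, zero_pow two_ne_zero, div_zero, abs_zero]
      positivity
    · have hx' : ‖x‖ ≠ 0 := norm_ne_zero_iff.2 hx
      have := hquad (‖x‖⁻¹ • x) (by simp [norm_smul, hx'])
      have e : T.rayleighQuotient x = ⟪T (‖x‖⁻¹ • x), ‖x‖⁻¹ • x⟫ := by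
        rw [ContinuousLinearMap.rayleighQuotient, ContinuousLinearMap.reApplyInnerSelf_apply,
          map_smul, real_inner_smul_left, real_inner_smul_right, RCLike.re_to_real]
        field_simp
      rwa [e]
  linarith

/-! ### Bernstein's inequality -/

/-- A nonnegative random variable `W` with `E exp W ≤ 2` is, after centering, sub-exponential. -/
lemma mgf_centered_le {Ω : Type*} [MeasurableSpace Ω] {P : Measure Ω} [IsProbabilityMeasure P]
    {W : Ω → ℝ} (hW0 : ∀ ω, 0 ≤ W ω) (hWm : AEMeasurable W P)
    (hW : ∫⁻ ω, ENNReal.ofReal (Real.exp (W ω)) ∂P ≤ 2) {t : ℝ} (ht : |t| ≤ 1 / 2) :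
    Integrable (fun ω => Real.exp (t * (W ω - ∫ ω, W ω ∂P))) P ∧
      mgf (fun ω => W ω - ∫ ω, W ω ∂P) P t ≤ Real.exp (44 * t ^ 2) := by
  have hexpi : Integrable (fun ω => Real.exp (W ω)) P := by
    refine ⟨hWm.exp.aestronglyMeasurable, ?_⟩
    rw [hasFiniteIntegral_iff_ofReal (ae_of_all _ fun ω => (Real.exp_pos _).le)]
    exact hW.trans_lt (by simp)
  have hexp2 : ∫ ω, Real.exp (W ω) ∂P ≤ 2 := by
    rw [integral_eq_lintegral_of_nonneg_ae (ae_of_all _ fun ω => (Real.exp_pos _).le)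
      hWm.exp.aestronglyMeasurable]
    exact ENNReal.toReal_le_of_le_ofReal (by norm_num) (by simpa using hW)
  have hWi : Integrable W P := by
    refine hexpi.mono' hWm.aestronglyMeasurable (ae_of_all _ fun ω => ?_)
    rw [Real.norm_of_nonneg (hW0 ω)]
    linarith [Real.add_one_le_exp (W ω)]
  set a := ∫ ω, W ω ∂P with ha
  have ha0 : 0 ≤ a := integral_nonneg hW0
  have ha1 : a ≤ 1 := by
    have : ∫ ω, (W ω + 1) ∂P ≤ ∫ ω, Real.exp (W ω) ∂P :=
      integral_mono (hWi.add (integrable_const 1)) hexpi fun ω => Real.add_one_le_exp _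
    rw [integral_add hWi (integrable_const 1)] at this
    simp at this
    linarith
  -- Second-order Taylor bound: since `|t| ≤ 1/2`, the quadratic factor and the exponential of the
  -- remainder each cost at most a multiple of `exp ((w + 1) / 2)`, together one integrable `exp w`.
  have hpt : ∀ ω, Real.exp (t * (W ω - a)) ≤
      1 + t * (W ω - a) + 8 * t ^ 2 * Real.exp 1 * Real.exp (W ω) := by
    intro ω
    set w := W ω with hw
    have hw0 : 0 ≤ w := hW0 ω
    have habs : |w - a| ≤ w + 1 := abs_le.2 ⟨by linarith, by linarith⟩
    have h1 : |Real.exp (t * (w - a)) - (1 + t * (w - a))| ≤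
        |t * (w - a)| ^ 2 * Real.exp |t * (w - a)| := by
      have := Complex.norm_exp_sub_sum_le_norm_mul_exp ((t * (w - a) : ℝ) : ℂ) 2
      simp only [Finset.sum_range_succ, Finset.sum_range_zero, pow_zero, pow_one, Nat.factorial,
        Nat.cast_one, zero_add, div_one, mul_one] at this
      rw [← Complex.ofReal_exp, ← Complex.ofReal_one, ← Complex.ofReal_add, ← Complex.ofReal_sub,
        Complex.norm_real, Complex.norm_real] at this
      exact this
    have h2 : |t * (w - a)| ≤ (w + 1) / 2 := by
      rw [abs_mul]
      nlinarith [abs_nonneg t, abs_nonneg (w - a)]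
    have h3 : |t * (w - a)| ^ 2 ≤ t ^ 2 * (w + 1) ^ 2 := by
      rw [abs_mul, mul_pow, sq_abs]
      gcongr
    have h4 : (w + 1) ^ 2 ≤ 8 * Real.exp ((w + 1) / 2) := by
      have := Real.quadratic_le_exp_of_nonneg (x := (w + 1) / 2) (by positivity)
      nlinarith
    have h5 : |t * (w - a)| ^ 2 * Real.exp |t * (w - a)| ≤
        8 * t ^ 2 * Real.exp 1 * Real.exp w := by
      calc |t * (w - a)| ^ 2 * Real.exp |t * (w - a)|
          ≤ (t ^ 2 * (8 * Real.exp ((w + 1) / 2))) * Real.exp ((w + 1) / 2) := by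
            refine mul_le_mul (h3.trans ?_) (Real.exp_le_exp.2 h2) (Real.exp_pos _).le
              (by positivity)
            gcongr
        _ = 8 * t ^ 2 * (Real.exp ((w + 1) / 2) * Real.exp ((w + 1) / 2)) := by ring
        _ = 8 * t ^ 2 * (Real.exp 1 * Real.exp w) := by
            rw [← Real.exp_add, ← Real.exp_add]; ring_nf
        _ = _ := by ring
    linarith [(abs_le.1 (h1.trans h5)).2]
  have hint : Integrable (fun ω => 1 + t * (W ω - a) + 8 * t ^ 2 * Real.exp 1 * Real.exp (W ω)) P :=
    ((integrable_const 1).add ((hWi.sub (integrable_const a)).const_mul t)).add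
      (hexpi.const_mul _)
  have hI : Integrable (fun ω => Real.exp (t * (W ω - a))) P := by
    refine hint.mono' ((hWm.sub_const a).const_mul t).exp.aestronglyMeasurable
      (ae_of_all _ fun ω => ?_)
    rw [Real.norm_of_nonneg (Real.exp_pos _).le]
    exact hpt ω
  refine ⟨hI, ?_⟩
  calc mgf (fun ω => W ω - a) P t
      ≤ ∫ ω, (1 + t * (W ω - a) + 8 * t ^ 2 * Real.exp 1 * Real.exp (W ω)) ∂P :=
        integral_mono hI hint hpt
    _ = 1 + 8 * t ^ 2 * Real.exp 1 * ∫ ω, Real.exp (W ω) ∂P := by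
        have hlin : Integrable (fun ω => t * (W ω - a)) P :=
          (hWi.sub (integrable_const a)).const_mul t
        have hone : Integrable (fun ω => 1 + t * (W ω - a)) P := (integrable_const 1).add hlin
        rw [integral_add hone (hexpi.const_mul _), integral_add (integrable_const 1) hlin,
          integral_const_mul, integral_const_mul,
          integral_sub hWi (integrable_const a)]
        simp [← ha]
    _ ≤ 1 + 8 * t ^ 2 * 2.7182818286 * 2 := by
        gcongr
        exact Real.exp_one_lt_d9.le
    _ ≤ 44 * t ^ 2 + 1 := by nlinarith [sq_nonneg t]
    _ ≤ Real.exp (44 * t ^ 2) := Real.add_one_le_exp _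

/-- The exponent in Bernstein's inequality. -/
lemma exists_bernstein_exponent {r : ℝ} (hr : 0 ≤ r) :
    ∃ t : ℝ, 0 ≤ t ∧ t ≤ 1 / 2 ∧ r ≤ t * (90 * (√r + r)) - 44 * t ^ 2 := by
  have hs := Real.sqrt_nonneg r
  have hsq := Real.sq_sqrt hr
  -- The gaussian regime takes `t = √r`; the exponential regime takes the largest admissible `t`.
  rcases le_total √r (1 / 2) with h | h
  · exact ⟨√r, hs, h, by nlinarith⟩
  · exact ⟨1 / 2, by norm_num, le_rfl, by nlinarith⟩

/-- Bernstein's inequality for averages of independent nonnegative random variables with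
`E exp W ≤ 2`. -/
lemma measureReal_abs_average_ge_le {Ω : Type*} [MeasurableSpace Ω] {P : Measure Ω}
    [IsProbabilityMeasure P] {m : ℕ} (hm : 0 < m) {W : Fin m → Ω → ℝ} (hind : iIndepFun W P)
    (hW0 : ∀ i ω, 0 ≤ W i ω) (hWm : ∀ i, AEMeasurable (W i) P)
    (hW : ∀ i, ∫⁻ ω, ENNReal.ofReal (Real.exp (W i ω)) ∂P ≤ 2) {r : ℝ} (hr : 0 ≤ r) :
    P.real {ω | 90 * (√r + r) ≤ |(1 / m : ℝ) * ∑ i, (W i ω - ∫ ω, W i ω ∂P)|} ≤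
      2 * Real.exp (-(m * r)) := by
  obtain ⟨t, ht0, ht2, ht⟩ := exists_bernstein_exponent hr
  set s := 90 * (√r + r) with hs
  have hm' : (0 : ℝ) < m := by exact_mod_cast hm
  set Z : Fin m → Ω → ℝ := fun i ω => W i ω - ∫ ω, W i ω ∂P with hZ
  have hZm : ∀ i, AEMeasurable (Z i) P := fun i => (hWm i).sub_const _
  have hZind : iIndepFun Z P :=
    hind.comp (fun i x => x - ∫ ω, W i ω ∂P) (fun i => by fun_prop)
  have hmgf : ∀ q : ℝ, |q| ≤ 1 / 2 → mgf (∑ i, Z i) P q ≤ Real.exp (m * (44 * q ^ 2)) := by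
    intro q hq
    rw [hZind.mgf_sum₀ hZm]
    calc ∏ i, mgf (Z i) P q ≤ ∏ _i : Fin m, Real.exp (44 * q ^ 2) :=
          Finset.prod_le_prod (fun i _ => mgf_nonneg)
            fun i _ => (mgf_centered_le (hW0 i) (hWm i) (hW i) hq).2
      _ = Real.exp (m * (44 * q ^ 2)) := by
          rw [Finset.prod_const, Finset.card_univ, Fintype.card_fin, ← Real.exp_nat_mul]
  have hint : ∀ q : ℝ, |q| ≤ 1 / 2 → Integrable (fun ω => Real.exp (q * (∑ i, Z i) ω)) P := by
    intro q hq
    -- A non-integrable exponential would make `mgf` take its default value `0`, but it is a product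
    -- of positive factors.
    by_contra hni
    have hzero : mgf (∑ i, Z i) P q = 0 := integral_undef hni
    rw [hZind.mgf_sum₀ hZm] at hzero
    exact (Finset.prod_pos fun i _ =>
      mgf_pos (mgf_centered_le (hW0 i) (hWm i) (hW i) hq).1).ne' hzero
  have habs : |t| ≤ 1 / 2 := by rwa [abs_of_nonneg ht0]
  have hexp : Real.exp (-t * (m * s)) * Real.exp (m * (44 * t ^ 2)) ≤ Real.exp (-(m * r)) := by
    rw [← Real.exp_add]
    refine Real.exp_le_exp.2 ?_
    nlinarith
  have hup : P.real {ω | m * s ≤ (∑ i, Z i) ω} ≤ Real.exp (-(m * r)) :=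
    (measure_ge_le_exp_mul_mgf (m * s) ht0 (hint t habs)).trans
      ((mul_le_mul_of_nonneg_left (hmgf t habs) (Real.exp_pos _).le).trans hexp)
  have hdown : P.real {ω | (∑ i, Z i) ω ≤ -(m * s)} ≤ Real.exp (-(m * r)) := by
    have h := measure_le_le_exp_mul_mgf (-(m * s)) (neg_nonpos.2 ht0)
      (hint (-t) (by rwa [abs_neg]))
    refine h.trans ((mul_le_mul_of_nonneg_left (hmgf (-t) (by rwa [abs_neg]))
      (Real.exp_pos _).le).trans (le_of_eq_of_le ?_ hexp))
    rw [neg_sq]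
    congr 2
    ring
  calc _ ≤ P.real ({ω | m * s ≤ (∑ i, Z i) ω} ∪ {ω | (∑ i, Z i) ω ≤ -(m * s)}) := by
        refine measureReal_mono fun ω hω => ?_
        simp only [Set.mem_union, Set.mem_ofPred_eq, Finset.sum_apply] at hω ⊢
        rw [abs_mul, abs_of_nonneg (by positivity : (0 : ℝ) ≤ 1 / m), one_div, inv_mul_eq_div,
          le_div_iff₀ hm', le_abs] at hω
        rcases hω with h | h
        · left; linarith
        · right; linarith
    _ ≤ _ := (measureReal_union_le _ _).trans (by linarith)

/-! ### Top eigenvalues and Gaussian second moments -/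

lemma inner_toEuclideanCLM_comm {n : ℕ} {A : Matrix (Fin n) (Fin n) ℝ} (hA : A.IsHermitian)
    (x y : EuclideanSpace ℝ (Fin n)) :
    ⟪Matrix.toEuclideanCLM (n := Fin n) (𝕜 := ℝ) A x, y⟫ =
      ⟪x, Matrix.toEuclideanCLM (n := Fin n) (𝕜 := ℝ) A y⟫ :=
  Matrix.isSymmetric_toEuclideanLin_iff.mpr hA x y

lemma eigenvalues_le_lambda1 {n : ℕ} (hn : 0 < n) {A : Matrix (Fin n) (Fin n) ℝ}
    (hA : A.IsHermitian) (i : Fin n) : hA.eigenvalues i ≤ lambda1 hn hA :=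
  hA.eigenvalues₀_antitone (Fin.le_def.2 (Nat.zero_le _))

lemma lambda1_pos {n : ℕ} (hn : 0 < n) {A : Matrix (Fin n) (Fin n) ℝ} (hA : A.PosDef) :
    0 < lambda1 hn hA.isHermitian :=
  (hA.eigenvalues_pos ⟨0, hn⟩).trans_le (eigenvalues_le_lambda1 hn hA.isHermitian _)

/-- The quadratic form of a symmetric matrix is bounded by its largest eigenvalue. -/
lemma inner_toEuclideanCLM_self_le {n : ℕ} (hn : 0 < n) {A : Matrix (Fin n) (Fin n) ℝ}
    (hA : A.IsHermitian) (x : EuclideanSpace ℝ (Fin n)) :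
    ⟪x, Matrix.toEuclideanCLM (n := Fin n) (𝕜 := ℝ) A x⟫ ≤ lambda1 hn hA * ‖x‖ ^ 2 := by
  set T := Matrix.toEuclideanCLM (n := Fin n) (𝕜 := ℝ) A with hT
  set b := hA.eigenvectorBasis
  have hb : ∀ i, T (b i) = hA.eigenvalues i • b i := fun i => by
    ext j
    exact congrFun (hA.mulVec_eigenvectorBasis i) j
  rw [← b.sum_inner_mul_inner x (T x), ← b.sum_sq_inner_left x, Finset.mul_sum]
  refine Finset.sum_le_sum fun i _ => ?_
  have e : ⟪b i, T x⟫ = hA.eigenvalues i * ⟪b i, x⟫ := by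
    rw [← inner_toEuclideanCLM_comm hA, ← hT, hb, real_inner_smul_left]
  rw [e, real_inner_comm (b i) x]
  nlinarith [eigenvalues_le_lambda1 hn hA i, sq_nonneg ⟪b i, x⟫]

lemma integral_inner_sq_gaussian {n : ℕ} {S : Matrix (Fin n) (Fin n) ℝ} (hS : S.PosSemidef)
    (x : EuclideanSpace ℝ (Fin n)) :
    ∫ y, ⟪y, x⟫ ^ 2 ∂(multivariateGaussian 0 S) =
      ⟪x, Matrix.toEuclideanCLM (n := Fin n) (𝕜 := ℝ) S x⟫ := by
  rw [Matrix.inner_toEuclideanCLM, ← covarianceBilin_multivariateGaussian (μ := 0) hS,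
    covarianceBilin_apply IsGaussian.memLp_two_id]
  refine integral_congr_ae (ae_of_all _ fun y => ?_)
  simp only [id_eq, integral_id_multivariateGaussian, sub_zero, real_inner_comm x y, sq]

lemma integrable_inner_sq_gaussian {n : ℕ} {S : Matrix (Fin n) (Fin n) ℝ}
    (x : EuclideanSpace ℝ (Fin n)) :
    Integrable (fun y => ⟪y, x⟫ ^ 2) (multivariateGaussian 0 S) := by
  have h : MemLp id 2 (multivariateGaussian (0 : EuclideanSpace ℝ (Fin n)) S) :=
    IsGaussian.memLp_two_id
  exact (h.inner_const x).integrable_sq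

/-! ### Second moments of the mixture -/

section Mixture

variable {Ω : Type*} [MeasurableSpace Ω] {P : Measure Ω} [IsProbabilityMeasure P] {n : ℕ}
  {μ : EuclideanSpace ℝ (Fin n)} {S₁ S₂ : Matrix (Fin n) (Fin n) ℝ} {θ : Ω → ℝ}
  {g₁ g₂ X : Ω → EuclideanSpace ℝ (Fin n)}

lemma IsMixture.ae_theta (h : IsMixture P μ S₁ S₂ θ g₁ g₂ X) : ∀ᵐ ω ∂P, θ ω = 1 ∨ θ ω = -1 := by
  have hm₁ : NullMeasurableSet {ω | θ ω = 1} P :=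
    h.aemeasurable_theta.nullMeasurable (measurableSet_singleton 1)
  have hm₂ : NullMeasurableSet {ω | θ ω = -1} P :=
    h.aemeasurable_theta.nullMeasurable (measurableSet_singleton (-1))
  have hdisj : Disjoint {ω | θ ω = 1} {ω | θ ω = -1} := by
    rw [Set.disjoint_left]
    intro ω h1 h2
    rw [Set.mem_ofPred_eq] at h1 h2
    linarith
  have hone : P ({ω | θ ω = 1} ∪ {ω | θ ω = -1}) = 1 := by
    rw [measure_union₀ hm₂ hdisj.aedisjoint, h.theta_pos, h.theta_neg, ENNReal.add_halves]
  exact (prob_compl_eq_zero_iff₀ (hm₁.union hm₂)).2 hone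

/-- Bounding the selected Gaussian square by the sum of both avoids conditioning on `θ`, at the cost
of a constant. -/
lemma IsMixture.ae_inner_sq_le (h : IsMixture P μ S₁ S₂ θ g₁ g₂ X)
    (x : EuclideanSpace ℝ (Fin n)) :
    ∀ᵐ ω ∂P, ⟪X ω, x⟫ ^ 2 ≤ 2 * ⟪μ, x⟫ ^ 2 + 2 * (⟪g₁ ω, x⟫ ^ 2 + ⟪g₂ ω, x⟫ ^ 2) := by
  filter_upwards [h.ae_theta] with ω hω
  rw [h.eq_mixture ω, inner_add_left, real_inner_smul_left]
  have hθ : θ ω ^ 2 = 1 := by rcases hω with h | h <;> rw [h] <;> norm_num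
  have hsq : (θ ω * ⟪μ, x⟫) ^ 2 = ⟪μ, x⟫ ^ 2 := by rw [mul_pow, hθ, one_mul]
  rw [← hsq]
  split_ifs
  · nlinarith [sq_nonneg (θ ω * ⟪μ, x⟫ - ⟪g₁ ω, x⟫), sq_nonneg ⟪g₂ ω, x⟫]
  · nlinarith [sq_nonneg (θ ω * ⟪μ, x⟫ - ⟪g₂ ω, x⟫), sq_nonneg ⟪g₁ ω, x⟫]

/-- The variance of a one-dimensional marginal of the mixture. -/
lemma IsMixture.eLpNorm_inner_le (h : IsMixture P μ S₁ S₂ θ g₁ g₂ X) (hn : 0 < n)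
    (hS₁ : S₁.PosDef) (hS₂ : S₂.PosDef) {x : EuclideanSpace ℝ (Fin n)} (hx : ‖x‖ = 1) :
    eLpNorm (fun ω => ⟪X ω, x⟫) 2 P ≤ ENNReal.ofReal
      √(4 * ((lambda1 hn hS₁.isHermitian + lambda1 hn hS₂.isHermitian) / 2 + ‖μ‖ ^ 2)) := by
  have hi₁ : Integrable (fun ω => ⟪g₁ ω, x⟫ ^ 2) P := by
    have := integrable_inner_sq_gaussian (S := S₁) x
    rw [← h.law₁.map_eq] at this
    exact this.comp_aemeasurable h.law₁.aemeasurable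
  have hi₂ : Integrable (fun ω => ⟪g₂ ω, x⟫ ^ 2) P := by
    have := integrable_inner_sq_gaussian (S := S₂) x
    rw [← h.law₂.map_eq] at this
    exact this.comp_aemeasurable h.law₂.aemeasurable
  have hb₁ : ∫ ω, ⟪g₁ ω, x⟫ ^ 2 ∂P ≤ lambda1 hn hS₁.isHermitian := by
    have e := h.law₁.integral_comp (f := fun y => ⟪y, x⟫ ^ 2)
      (Continuous.aestronglyMeasurable (by fun_prop))
    have l := inner_toEuclideanCLM_self_le hn hS₁.isHermitian x
    rw [hx, one_pow, mul_one, ← integral_inner_sq_gaussian hS₁.posSemidef, ← e] at l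
    exact l
  have hb₂ : ∫ ω, ⟪g₂ ω, x⟫ ^ 2 ∂P ≤ lambda1 hn hS₂.isHermitian := by
    have e := h.law₂.integral_comp (f := fun y => ⟪y, x⟫ ^ 2)
      (Continuous.aestronglyMeasurable (by fun_prop))
    have l := inner_toEuclideanCLM_self_le hn hS₂.isHermitian x
    rw [hx, one_pow, mul_one, ← integral_inner_sq_gaussian hS₂.posSemidef, ← e] at l
    exact l
  have hμ : ⟪μ, x⟫ ^ 2 ≤ ‖μ‖ ^ 2 := by
    have := abs_real_inner_le_norm μ x
    rw [hx, mul_one] at this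
    exact sq_le_sq' (by linarith [(abs_le.1 this).1]) (abs_le.1 this).2
  have hsum : Integrable (fun ω => 2 * (⟪g₁ ω, x⟫ ^ 2 + ⟪g₂ ω, x⟫ ^ 2)) P :=
    (hi₁.add hi₂).const_mul 2
  have hlin : ∫⁻ ω, ‖⟪X ω, x⟫‖ₑ ^ (2 : ℝ) ∂P ≤ ENNReal.ofReal
      (4 * ((lambda1 hn hS₁.isHermitian + lambda1 hn hS₂.isHermitian) / 2 + ‖μ‖ ^ 2)) := by
    calc ∫⁻ ω, ‖⟪X ω, x⟫‖ₑ ^ (2 : ℝ) ∂P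
        ≤ ∫⁻ ω, ENNReal.ofReal
            (2 * ⟪μ, x⟫ ^ 2 + 2 * (⟪g₁ ω, x⟫ ^ 2 + ⟪g₂ ω, x⟫ ^ 2)) ∂P := by
          refine lintegral_mono_ae ?_
          filter_upwards [h.ae_inner_sq_le x] with ω hω
          rw [Real.enorm_eq_ofReal_abs, ENNReal.ofReal_rpow_of_nonneg (abs_nonneg _) (by norm_num),
            Real.rpow_two, sq_abs]
          exact ENNReal.ofReal_le_ofReal hω
      _ = ENNReal.ofReal
            (∫ ω, (2 * ⟪μ, x⟫ ^ 2 + 2 * (⟪g₁ ω, x⟫ ^ 2 + ⟪g₂ ω, x⟫ ^ 2)) ∂P) :=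
          (ofReal_integral_eq_lintegral_ofReal ((integrable_const _).add hsum)
            (ae_of_all _ fun ω => add_nonneg (mul_nonneg zero_le_two (sq_nonneg _))
              (mul_nonneg zero_le_two (add_nonneg (sq_nonneg _) (sq_nonneg _))))).symm
      _ ≤ _ := by
          refine ENNReal.ofReal_le_ofReal ?_
          rw [integral_add (integrable_const _) hsum, integral_const, probReal_univ, one_smul,
            integral_const_mul, integral_add hi₁ hi₂]
          nlinarith [sq_nonneg ‖μ‖]
  rw [eLpNorm_eq_lintegral_rpow_enorm_toReal two_ne_zero ENNReal.ofNat_ne_top,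
    ENNReal.toReal_ofNat, Real.sqrt_eq_rpow,
    ← ENNReal.ofReal_rpow_of_nonneg ?_ (by norm_num)]
  · gcongr
  · have h₁ : 0 ≤ ∫ ω, ⟪g₁ ω, x⟫ ^ 2 ∂P := integral_nonneg fun _ => sq_nonneg _
    have h₂ : 0 ≤ ∫ ω, ⟪g₂ ω, x⟫ ^ 2 ∂P := integral_nonneg fun _ => sq_nonneg _
    nlinarith [sq_nonneg ‖μ‖]

end Mixture

/-! ### Exponential moments and quadratic forms of covariance matrices -/

/-- Below every threshold larger than the `ψ₂`-norm the exponential moment is at most `2`. -/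
lemma lintegral_exp_sq_le_of_psi2Norm_lt {Ω : Type*} [MeasurableSpace Ω] {P : Measure Ω}
    {Y : Ω → ℝ} {T : ℝ} (h : psi2Norm Y P < ENNReal.ofReal T) :
    ∫⁻ ω, ENNReal.ofReal (Real.exp (Y ω ^ 2 / T ^ 2)) ∂P ≤ 2 := by
  obtain ⟨t, ht⟩ := iInf_lt_iff.1 h
  obtain ⟨⟨ht0, hle⟩, ht'⟩ := iInf_lt_iff.1 ht
  have htT : t < T := (ENNReal.ofReal_lt_ofReal_iff_of_nonneg ht0.le).1 ht'
  refine (lintegral_mono fun ω => ?_).trans hle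
  gcongr

section Covariance

variable {Ω : Type*} [MeasurableSpace Ω] {P : Measure Ω} {n : ℕ}
  {X : Ω → EuclideanSpace ℝ (Fin n)}

lemma inner_toEuclideanCLM_eq_sum (A : Matrix (Fin n) (Fin n) ℝ) (x : EuclideanSpace ℝ (Fin n)) :
    ⟪Matrix.toEuclideanCLM (n := Fin n) (𝕜 := ℝ) A x, x⟫ = ∑ i, ∑ j, x i * x j * A i j := by
  rw [real_inner_comm, Matrix.inner_toEuclideanCLM]
  simp only [dotProduct, Matrix.mulVec, Finset.mul_sum]
  refine Finset.sum_congr rfl fun i _ => Finset.sum_congr rfl fun j _ => by ring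

lemma inner_sq_eq_sum (y x : EuclideanSpace ℝ (Fin n)) :
    ⟪y, x⟫ ^ 2 = ∑ i, ∑ j, x i * x j * (y i * y j) := by
  rw [sq, PiLp.inner_apply, Finset.sum_mul_sum]
  refine Finset.sum_congr rfl fun i _ => Finset.sum_congr rfl fun j _ => ?_
  simp
  ring

lemma inner_covMatrix (hX : ∀ i, MemLp (fun ω => X ω i) 2 P) (x : EuclideanSpace ℝ (Fin n)) :
    ⟪Matrix.toEuclideanCLM (n := Fin n) (𝕜 := ℝ) (covMatrix P X) x, x⟫ =
      ∫ ω, ⟪X ω, x⟫ ^ 2 ∂P := by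
  have hi : ∀ i j, Integrable (fun ω => x i * x j * (X ω i * X ω j)) P :=
    fun i j => ((hX i).integrable_mul (hX j)).const_mul _
  simp_rw [inner_toEuclideanCLM_eq_sum, inner_sq_eq_sum, covMatrix, Matrix.of_apply]
  rw [integral_finsetSum _ fun i _ => integrable_finsetSum _ fun j _ => hi i j]
  refine Finset.sum_congr rfl fun i _ => ?_
  rw [integral_finsetSum _ fun j _ => hi i j]
  exact Finset.sum_congr rfl fun j _ => (integral_const_mul _ _).symm

lemma inner_sampleCov {m : ℕ} (y : Fin m → EuclideanSpace ℝ (Fin n))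
    (x : EuclideanSpace ℝ (Fin n)) :
    ⟪Matrix.toEuclideanCLM (n := Fin n) (𝕜 := ℝ) (sampleCov y) x, x⟫ =
      (1 / m : ℝ) * ∑ k, ⟪y k, x⟫ ^ 2 := by
  have h : ∀ k, ⟪Matrix.toEuclideanCLM (n := Fin n) (𝕜 := ℝ)
      (Matrix.vecMulVec (y k).ofLp (y k).ofLp) x, x⟫ = ⟪y k, x⟫ ^ 2 := fun k => by
    simp only [inner_toEuclideanCLM_eq_sum, inner_sq_eq_sum, Matrix.vecMulVec_apply]
  rw [sampleCov, map_smul, map_sum, smul_apply, sum_apply,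
    real_inner_smul_left, sum_inner]
  simp_rw [h]

lemma isHermitian_covMatrix : (covMatrix P X).IsHermitian := by
  ext i j
  simp [covMatrix, mul_comm]

lemma isHermitian_sampleCov {m : ℕ} (y : Fin m → EuclideanSpace ℝ (Fin n)) :
    (sampleCov y).IsHermitian := by
  ext i j
  simp [sampleCov, Matrix.sum_apply, Matrix.vecMulVec_apply, mul_comm]

end Covariance

/-! ### Concentration: one direction, then the union bound -/

/-- Concentration of a single quadratic form of the sample covariance matrix. -/
lemma measureReal_inner_sampleCov_sub_covMatrix_ge_le {Ω₀ Ω : Type*} [MeasurableSpace Ω₀]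
    [MeasurableSpace Ω] {P₀ : Measure Ω₀} {P : Measure Ω} [IsProbabilityMeasure P] {n m : ℕ}
    (hm : 0 < m) {X : Ω₀ → EuclideanSpace ℝ (Fin n)} (hX : ∀ i, MemLp (fun ω => X ω i) 2 P₀)
    {Xs : Fin m → Ω → EuclideanSpace ℝ (Fin n)} (hind : iIndepFun Xs P)
    (hid : ∀ i, IdentDistrib (Xs i) X P P₀) {x : EuclideanSpace ℝ (Fin n)} {T : ℝ} (hT : 0 < T)
    (hpsi : psi2Norm (fun ω => ⟪X ω, x⟫) P₀ < ENNReal.ofReal T) {r : ℝ} (hr : 0 ≤ r) :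
    P.real {ω | T ^ 2 * (90 * (√r + r)) ≤ |⟪Matrix.toEuclideanCLM (n := Fin n) (𝕜 := ℝ)
        (sampleCov (fun i => Xs i ω) - covMatrix P₀ X) x, x⟫|} ≤ 2 * Real.exp (-(m * r)) := by
  have hf : Measurable fun y : EuclideanSpace ℝ (Fin n) => ⟪y, x⟫ ^ 2 / T ^ 2 := by fun_prop
  have hidW : ∀ i, IdentDistrib (fun ω => ⟪Xs i ω, x⟫ ^ 2 / T ^ 2)
      (fun ω => ⟪X ω, x⟫ ^ 2 / T ^ 2) P P₀ := fun i => (hid i).comp hf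
  have hexp : ∀ i, ∫⁻ ω, ENNReal.ofReal (Real.exp (⟪Xs i ω, x⟫ ^ 2 / T ^ 2)) ∂P ≤ 2 := fun i =>
    (((hidW i).comp (u := fun z => ENNReal.ofReal (Real.exp z)) (by fun_prop)).lintegral_eq).trans_le
      (lintegral_exp_sq_le_of_psi2Norm_lt hpsi)
  have hmean : ∀ i, ∫ ω, ⟪Xs i ω, x⟫ ^ 2 / T ^ 2 ∂P = (∫ ω, ⟪X ω, x⟫ ^ 2 ∂P₀) / T ^ 2 := fun i =>
    ((hidW i).integral_eq).trans (integral_div _ _)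
  have hm' : (m : ℝ) ≠ 0 := by exact_mod_cast hm.ne'
  have hkey := measureReal_abs_average_ge_le hm (hind.comp (fun _ y => ⟪y, x⟫ ^ 2 / T ^ 2)
    fun _ => hf) (fun i ω => by dsimp; positivity) (fun i => (hidW i).aemeasurable_fst) hexp hr
  refine (measureReal_mono fun ω hω => ?_).trans hkey
  rw [Set.mem_ofPred_eq] at hω ⊢
  have e : ⟪Matrix.toEuclideanCLM (n := Fin n) (𝕜 := ℝ)
        (sampleCov (fun i => Xs i ω) - covMatrix P₀ X) x, x⟫ =
      T ^ 2 * ((1 / m : ℝ) * ∑ i, (⟪Xs i ω, x⟫ ^ 2 / T ^ 2 -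
        ∫ ω, ⟪Xs i ω, x⟫ ^ 2 / T ^ 2 ∂P)) := by
    simp_rw [hmean]
    rw [map_sub, sub_apply, inner_sub_left, inner_sampleCov,
      inner_covMatrix hX, Finset.sum_sub_distrib, ← Finset.sum_div, Finset.sum_const,
      Finset.card_univ, Fintype.card_fin, nsmul_eq_mul]
    field_simp
  rw [e, abs_mul, abs_of_nonneg (sq_nonneg T)] at hω
  exact le_of_mul_le_mul_left hω (by positivity)

/-- Concentration of the sample covariance matrix of a random vector whose marginals in unit
directions have `ψ₂`-norm smaller than `T`. -/
lemma measureReal_opNorm_sampleCov_sub_covMatrix_gt_le {Ω₀ Ω : Type*} [MeasurableSpace Ω₀]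
    [MeasurableSpace Ω] {P₀ : Measure Ω₀} {P : Measure Ω} [IsProbabilityMeasure P] {n m : ℕ}
    (hm : 0 < m) {X : Ω₀ → EuclideanSpace ℝ (Fin n)} (hX : ∀ i, MemLp (fun ω => X ω i) 2 P₀)
    {Xs : Fin m → Ω → EuclideanSpace ℝ (Fin n)} (hind : iIndepFun Xs P)
    (hid : ∀ i, IdentDistrib (Xs i) X P P₀) {T : ℝ} (hT : 0 < T)
    (hpsi : ∀ x : EuclideanSpace ℝ (Fin n), ‖x‖ = 1 →
      psi2Norm (fun ω => ⟪X ω, x⟫) P₀ < ENNReal.ofReal T) {r : ℝ} (hr : 0 ≤ r) :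
    P.real {ω | 32 * (T ^ 2 * (90 * (√r + r))) <
        opNorm (sampleCov (fun i => Xs i ω) - covMatrix P₀ X)} ≤
      2 * 5 ^ n * Real.exp (-(m * r)) := by
  obtain ⟨N, hNcard, hN1, hNnet⟩ := exists_half_net_unit_sphere (EuclideanSpace ℝ (Fin n))
  rw [finrank_euclideanSpace_fin] at hNcard
  have hsub : {ω | 32 * (T ^ 2 * (90 * (√r + r))) <
        opNorm (sampleCov (fun i => Xs i ω) - covMatrix P₀ X)} ⊆
      ⋃ y ∈ N, {ω | T ^ 2 * (90 * (√r + r)) ≤ |⟪Matrix.toEuclideanCLM (n := Fin n) (𝕜 := ℝ)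
        (sampleCov (fun i => Xs i ω) - covMatrix P₀ X) y, y⟫|} := by
    intro ω hω
    by_contra hcon
    simp only [Set.mem_iUnion, Set.mem_ofPred_eq, not_exists, not_le] at hcon
    have hsym : (sampleCov (fun i => Xs i ω) - covMatrix P₀ X).IsHermitian :=
      (isHermitian_sampleCov _).sub isHermitian_covMatrix
    have hle := norm_le_of_forall_mem_half_net _ (inner_toEuclideanCLM_comm hsym) hN1 hNnet
      (δ := T ^ 2 * (90 * (√r + r))) (by positivity) fun y hy => (hcon y hy).le
    exact not_le.2 hω hle
  refine (measureReal_mono hsub (measure_ne_top _ _)).trans ((measureReal_biUnion_finset_le _ _).trans ?_)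
  refine (Finset.sum_le_sum fun y hy => measureReal_inner_sampleCov_sub_covMatrix_ge_le hm hX hind
    hid hT (hpsi y (hN1 y hy)) hr).trans ?_
  have hN : (N.card : ℝ) ≤ 5 ^ n := by exact_mod_cast hNcard
  rw [Finset.sum_const, nsmul_eq_mul]
  nlinarith [mul_le_mul_of_nonneg_right hN (Real.exp_pos (-(m * r))).le]

/-- Since `5 ≤ exp 3`, the rate `3` absorbs the cardinality of the net. -/
lemma five_pow_mul_exp_le (n : ℕ) {u : ℝ} (hu : 0 ≤ u) :
    5 ^ n * Real.exp (-(3 * (n + u))) ≤ Real.exp (-u) := by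
  have h5 : (5 : ℝ) ≤ Real.exp 3 := by
    have := Real.quadratic_le_exp_of_nonneg (x := 3) (by norm_num)
    linarith
  calc 5 ^ n * Real.exp (-(3 * (n + u))) ≤ Real.exp 3 ^ n * Real.exp (-(3 * (n + u))) := by gcongr
    _ = Real.exp (-(3 * u)) := by
        rw [← Real.exp_nat_mul, ← Real.exp_add]
        ring_nf
    _ ≤ Real.exp (-u) := Real.exp_le_exp.2 (by linarith)

end AllometricMixture

theorem mainTheorem4 :
    ∃ C : ℝ, 0 < C ∧
      ∀ (n m : ℕ) (hn : 0 < n), 0 < m →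
      ∀ (μ : EuclideanSpace ℝ (Fin n)) (S₁ S₂ : Matrix (Fin n) (Fin n) ℝ)
        (hA : AllometricMixture.IsAllometric hn μ S₁ S₂)
        -- the population variable `X = θ μ + g^(θ)`
        {Ω₀ : Type*} [MeasurableSpace Ω₀] (P₀ : Measure Ω₀) [IsProbabilityMeasure P₀]
        (θ : Ω₀ → ℝ) (g₁ g₂ X : Ω₀ → EuclideanSpace ℝ (Fin n)),
        AllometricMixture.IsMixture P₀ μ S₁ S₂ θ g₁ g₂ X →
      -- the constant in the sub-gaussian property of `X`
      ∀ K : ℝ, 1 ≤ K →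
        (∀ x : EuclideanSpace ℝ (Fin n),
          AllometricMixture.psi2Norm (fun ω => ⟪X ω, x⟫) P₀ ≤
            ENNReal.ofReal K * eLpNorm (fun ω => ⟪X ω, x⟫) 2 P₀) →
      -- the sample: `m` independent copies of `X`
      ∀ {Ω : Type*} [MeasurableSpace Ω] (P : Measure Ω) [IsProbabilityMeasure P]
        (Xs : Fin m → Ω → EuclideanSpace ℝ (Fin n)),
        iIndepFun Xs P → (∀ i, IdentDistrib (Xs i) X P P₀) →
      ∀ u : ℝ, 0 ≤ u →
        1 - 2 * Real.exp (-u) ≤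
          P.real {ω |
            AllometricMixture.opNorm (AllometricMixture.sampleCov (fun i => Xs i ω) -
                AllometricMixture.covMatrix P₀ X) ≤
              C * K ^ 2 * (√((n + u) / m) + (n + u) / m) *
                ((AllometricMixture.lambda1 hn hA.posDef₁.isHermitian +
                  AllometricMixture.lambda1 hn hA.posDef₂.isHermitian) / 2 + ‖μ‖ ^ 2)} := by
  -- `138240 = 32 * 4 * 4 * 90 * 3`: net, `2 ^ 2` from `T ^ 2`, variance bound `4Λ`, Bernstein, and
  -- `r = 3q`.
  refine ⟨138240, by norm_num, ?_⟩
  intro n m hn hm μ S₁ S₂ hA Ω₀ _ P₀ _ θ g₁ g₂ X hmix K hK hpsi Ω _ P _ Xs hind hid u hu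
  set Λ := (AllometricMixture.lambda1 hn hA.posDef₁.isHermitian +
    AllometricMixture.lambda1 hn hA.posDef₂.isHermitian) / 2 + ‖μ‖ ^ 2 with hΛ
  have hΛpos : 0 < Λ := by
    have h₁ := AllometricMixture.lambda1_pos hn hA.posDef₁
    have h₂ := AllometricMixture.lambda1_pos hn hA.posDef₂
    positivity
  have hL2 : ∀ x : EuclideanSpace ℝ (Fin n), ‖x‖ = 1 →
      eLpNorm (fun ω => ⟪X ω, x⟫) 2 P₀ ≤ ENNReal.ofReal √(4 * Λ) :=
    fun x hx => hmix.eLpNorm_inner_le hn hA.posDef₁ hA.posDef₂ hx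
  have hXm : AEMeasurable X P₀ := (hid ⟨0, hm⟩).aemeasurable_snd
  have hmem : ∀ i, MemLp (fun ω => X ω i) 2 P₀ := by
    intro i
    have h := hL2 (EuclideanSpace.single i 1) (by simp)
    simp only [EuclideanSpace.inner_single_right, conj_trivial, one_mul] at h
    have hm : AEMeasurable (fun ω => X ω i) P₀ :=
      (by fun_prop : Measurable fun y : EuclideanSpace ℝ (Fin n) => y i).comp_aemeasurable hXm
    exact ⟨hm.aestronglyMeasurable, h.trans_lt ENNReal.ofReal_lt_top⟩
  have hKs : 0 < K * √(4 * Λ) := by positivity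
  -- The factor `2` makes the inequality strict, so that the exponential moment bound holds at this
  -- threshold even if the infimum is not attained.
  have hpsi' : ∀ x : EuclideanSpace ℝ (Fin n), ‖x‖ = 1 →
      AllometricMixture.psi2Norm (fun ω => ⟪X ω, x⟫) P₀ <
        ENNReal.ofReal (2 * (K * √(4 * Λ))) := by
    intro x hx
    calc AllometricMixture.psi2Norm (fun ω => ⟪X ω, x⟫) P₀
        ≤ ENNReal.ofReal K * ENNReal.ofReal √(4 * Λ) := (hpsi x).trans (by gcongr; exact hL2 x hx)
      _ = ENNReal.ofReal (K * √(4 * Λ)) := (ENNReal.ofReal_mul (by linarith)).symm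
      _ < _ := (ENNReal.ofReal_lt_ofReal_iff (by linarith)).2 (by linarith)
  have hm' : (0 : ℝ) < m := by exact_mod_cast hm
  set q : ℝ := (n + u) / m with hq
  have hq0 : 0 ≤ q := by positivity
  have hbad := AllometricMixture.measureReal_opNorm_sampleCov_sub_covMatrix_gt_le hm hmem hind hid
    (by linarith : 0 < 2 * (K * √(4 * Λ))) hpsi' (r := 3 * q) (by positivity)
  have hexp : 2 * 5 ^ n * Real.exp (-(m * (3 * q))) ≤ 2 * Real.exp (-u) := by
    have e : (m : ℝ) * (3 * q) = 3 * (n + u) := by rw [hq]; field_simp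
    rw [e, mul_assoc]
    exact mul_le_mul_of_nonneg_left (AllometricMixture.five_pow_mul_exp_le n hu) zero_le_two
  have hthr : 32 * ((2 * (K * √(4 * Λ))) ^ 2 * (90 * (√(3 * q) + 3 * q))) ≤
      138240 * K ^ 2 * (√q + q) * Λ := by
    have hsq : √(4 * Λ) ^ 2 = 4 * Λ := Real.sq_sqrt (by positivity)
    have h3 : √(3 * q) ≤ 3 * √q := by
      rw [Real.sqrt_mul (by norm_num)]
      gcongr
      rw [Real.sqrt_le_left (by norm_num)]
      norm_num
    calc 32 * ((2 * (K * √(4 * Λ))) ^ 2 * (90 * (√(3 * q) + 3 * q)))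
        = 32 * (4 * K ^ 2 * √(4 * Λ) ^ 2 * (90 * (√(3 * q) + 3 * q))) := by ring
      _ ≤ 32 * (4 * K ^ 2 * (4 * Λ) * (90 * (3 * √q + 3 * q))) := by rw [hsq]; gcongr
      _ = _ := by ring
  set good := {ω | AllometricMixture.opNorm (AllometricMixture.sampleCov (fun i => Xs i ω) -
    AllometricMixture.covMatrix P₀ X) ≤ 138240 * K ^ 2 * (√q + q) * Λ} with hgood
  have hcompl : P.real goodᶜ ≤ 2 * Real.exp (-u) := by
    refine ((measureReal_mono fun ω hω => ?_).trans hbad).trans hexp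
    exact hthr.trans_lt (not_le.1 hω)
  -- Subadditivity alone gives this, without measurability of `good`.
  have hone : 1 ≤ P.real good + P.real goodᶜ := by
    rw [← probReal_univ (μ := P), ← Set.union_compl_self good]
    exact measureReal_union_le _ _
  linarith
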